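/- Let $G=(V_G,E_G,s,t)$ be a finite directed graph (loops and parallel edges allowed) with $V_G=\{1,\dots,n\}$ and $m=|E_G|$ edges; let $\mathsf{in}(i)$, $\mathsf{out}(i)$ be the in- and outdegrees, $k=|\{\mathsf{out}(i)\mid i\in V_G\}|$ and $k^{\mathsf{in}}=|\{\mathsf{in}(i)\mid i\in V_G\}|$. Let $\mathsf{Aut}_0(G)\subseteq\mathfrak S_n$ be the group of the vertex permutations $f_0$ that belong to some automorphism $(f_0,f_1)$ of $G$, and for a sequence $x=(x_1,\dots,x_n)$ put $\sigma(x)=(x_{\sigma^{-1}(1)},\dots,x_{\sigma^{-1}(n)})$. A pile-scramble shuffle permutes several piles with equal numbers of cards uniformly at random, keeping the order inside each pile. A generalized pile-scramble applies, for each occurring pile size, one pile-scramble shuffle to all piles of that size. Consider the following protocol on an input $x$ of $n$ face-down cards. 1. Put next to $x$ the helping cards: $n$ piles, the $i$-th consisting of $\mathsf{in}(i)+1$ face-up copies of a card with symbol $i$. 2. Turn the helping cards face down and apply a generalized pile-scramble to these $n$ piles. Let $\alpha_i$ be the symbol of the pile now at place $i$. 3. For each vertex $i$ form the pile $\mathrm{vertex}[i]=(x_i,\alpha_i,\alpha_{w_{i,1}},\dots,\alpha_{w_{i,\mathsf{out}(i)}})$,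 where $w_{i,1},\dots,w_{i,\mathsf{out}(i)}$ are the targets, with multiplicity, of the edges with source $i$. 4. For each $i$ apply a pile-scramble shuffle to the last $\mathsf{out}(i)$ cards of $\mathrm{vertex}[i]$ (piles of one card). 5. Apply a generalized pile-scramble to the $n$ resulting piles. 6. Turn over all cards except the first card of each pile, and sort the piles so that their second cards are $1,2,\dots,n$. Let $y_i$ be the first card and $j^i_1,\dots,j^i_{d_i}$ the third and further cards of the $i$-th pile. 7. Let $G'$ be the directed graph with vertices $1,\dots,n$ and with one edge $i\to j^i_s$ for each $i$ and each $1\le s\le d_i$. 8. Choose, depending only on what has been visible, an isomorphism $\psi:G'\to G$ with vertex part $\psi_0$; output $z=(z_1,\dots,z_n)$ with $z_i=y_{\psi_0^{-1}(i)}$ and put the helping cards back as in step 1. The visible sequence trace is the list of the visible sequences (symbols of the face-up cards, "?" for face-down cards) at the start and after every operation. Then: * There are a random $\sigma\in\mathsf{Aut}_0(G)$ and a random trace, with a joint distribution that does not depend on $x$, such that for every input $x$ the final card sequence and the visible sequence trace of the protocol are jointly distributed as $\sigma(x)$ (followed by the helping cards as in step 1) and this trace. * (Correctness) $\sigma$ is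 uniformly distributed on $\mathsf{Aut}_0(G)$. * (Security) $\sigma$ and the visible sequence trace are stochastically independent. * The protocol uses $2n+m$ cards and $k^{\mathsf{in}}+k+n$ pile-scramble shuffles, which is $2k+n$ if $G$ has as many distinct indegrees as distinct outdegrees (for instance if $G$ comes from an undirected graph). -/

import Mathlib

/-! ### Directed graphs -/

/-- A directed graph with vertex set `V` and edge set `E`, given by its source and target maps
(loops and parallel edges are allowed). -/
structure DirectedGraph (V : Type*) (E : Type*) where
  src : E → V
  tgt : E → V

namespace DirectedGraph

/-- An isomorphism of directed graphs: a pair of bijections `(f₀, f₁)` compatible with sources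
and targets. -/
structure Iso {V V' E E' : Type*} (G : DirectedGraph V E) (G' : DirectedGraph V' E') where
  onVertices : V ≃ V'
  onEdges : E ≃ E'
  src_comm : ∀ e, G'.src (onEdges e) = onVertices (G.src e)
  tgt_comm : ∀ e, G'.tgt (onEdges e) = onVertices (G.tgt e)

/-- `Iso₀(G, G')`: the vertex parts of the isomorphisms from `G` to `G'`. -/
def Iso0 {V V' E E' : Type*} (G : DirectedGraph V E) (G' : DirectedGraph V' E') : Set (V ≃ V') :=
  {f | ∃ φ : Iso G G', φ.onVertices = f}

/-- `Aut₀(G) = Iso₀(G, G)`, as a subgroup of the group of permutations of the vertices. -/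
def Aut0 {V E : Type*} (G : DirectedGraph V E) : Subgroup (Equiv.Perm V) where
  carrier := Iso0 G G
  one_mem' := ⟨⟨Equiv.refl V, Equiv.refl E, fun _ => rfl, fun _ => rfl⟩, rfl⟩
  mul_mem' := by
    rintro _ _ ⟨φ, rfl⟩ ⟨χ, rfl⟩
    exact ⟨⟨χ.onVertices.trans φ.onVertices, χ.onEdges.trans φ.onEdges,
      fun e => by simp [φ.src_comm, χ.src_comm], fun e => by simp [φ.tgt_comm, χ.tgt_comm]⟩, rfl⟩
  inv_mem' := by
    rintro _ ⟨φ, rfl⟩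
    refine ⟨⟨φ.onVertices.symm, φ.onEdges.symm, fun e => ?_, fun e => ?_⟩, rfl⟩
    · rw [Equiv.eq_symm_apply, ← φ.src_comm, Equiv.apply_symm_apply]
    · rw [Equiv.eq_symm_apply, ← φ.tgt_comm, Equiv.apply_symm_apply]

noncomputable instance {V E : Type*} [Finite V] (G : DirectedGraph V E) : Fintype G.Aut0 :=
  Fintype.ofFinite _

/-- The indegree of a vertex. -/
def indeg {V E : Type*} [DecidableEq V] [Fintype E] (G : DirectedGraph V E) (v : V) : ℕ :=
  Fintype.card {e : E // G.tgt e = v}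

/-- The outdegree of a vertex. -/
def outdeg {V E : Type*} [DecidableEq V] [Fintype E] (G : DirectedGraph V E) (v : V) : ℕ :=
  Fintype.card {e : E // G.src e = v}

theorem sum_indeg {V E : Type*} [Fintype V] [DecidableEq V] [Fintype E] (G : DirectedGraph V E) :
    ∑ v, G.indeg v = Fintype.card E := by
  rw [← Fintype.card_congr (Equiv.sigmaFiberEquiv G.tgt), Fintype.card_sigma]
  rfl

theorem sum_outdeg {V E : Type*} [Fintype V] [DecidableEq V] [Fintype E] (G : DirectedGraph V E) :
    ∑ v, G.outdeg v = Fintype.card E := by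
  rw [← Fintype.card_congr (Equiv.sigmaFiberEquiv G.src), Fintype.card_sigma]
  rfl

end DirectedGraph

/-! ### Card-based protocols that shuffle by pile-scramble shuffles only -/

namespace CardProtocol

/-- A card with a symbol on its front side, lying face up or face down; all backs are equal. -/
structure Card (D : Type*) where
  symbol : D
  faceUp : Bool

/-- What is visible of a sequence of `N` cards: the symbols of the cards that lie face up, and
`none` for a card that lies face down. -/
abbrev Visible (D : Type*) (N : ℕ) : Type _ := Fin N → Option D

/-- The visible sequence of a card-sequence. -/
def visible {D : Type*} {N : ℕ} (c : Fin N → Card D) : Visible D N :=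
  fun q => if (c q).faceUp then some (c q).symbol else none

/-- A visible sequence trace: all visible sequences so far, the most recent one first. -/
abbrev Trace (D : Type*) (N : ℕ) : Type _ := List (Visible D N)

/-- The most recent visible sequence of a trace. -/
def Trace.last {D : Type*} {N : ℕ} (t : Trace D N) : Visible D N := t.headD fun _ => none

/-- The current card-sequence together with the visible sequence trace up to now. -/
structure Config (D : Type*) (N : ℕ) where
  cards : Fin N → Card D
  trace : Trace D N

/-- The configuration at the start of a protocol. -/
def Config.init {D : Type*} {N : ℕ} (c : Fin N → Card D) : Config D N := ⟨c, [visible c]⟩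

/-- Replace the card-sequence and record what is now visible. -/
def Config.update {D : Type*} {N : ℕ} (C : Config D N) (c : Fin N → Card D) : Config D N :=
  ⟨c, visible c :: C.trace⟩

/-- Rearrange the cards: the card at position `q` moves to position `π q`. -/
def Config.move {D : Type*} {N : ℕ} (C : Config D N) (π : Equiv.Perm (Fin N)) : Config D N :=
  C.update fun q => C.cards (π.symm q)

/-- The operations of a protocol on `N` cards.
* `turn T`: turn over the cards at the positions in `T`;
* `perm f`: rearrange the cards publicly, in a way that may depend on what has been visible;
* `pileScramble k l piles`: a pile-scramble shuffle of `k` disjoint piles of `l` cards each,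
  where `piles (i, j)` is the position of the `j`-th card of the `i`-th pile. -/
inductive Step (D : Type*) (N : ℕ) where
  | turn (T : Finset (Fin N))
  | perm (f : Trace D N → Equiv.Perm (Fin N))
  | pileScramble (k l : ℕ) (piles : Fin k × Fin l ↪ Fin N)

/-- Execute one operation. A pile-scramble shuffle permutes the piles by a uniformly random
permutation, keeps the order inside each pile and leaves all other cards in place. -/
noncomputable def Step.exec {D : Type*} {N : ℕ} : Step D N → Config D N → PMF (Config D N)
  | .turn T, C => PMF.pure <| C.update fun q =>
      if q ∈ T then ⟨(C.cards q).symbol, !(C.cards q).faceUp⟩ else C.cards q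
  | .perm f, C => PMF.pure <| C.move (f C.trace)
  | .pileScramble k _ piles, C => (PMF.uniformOfFintype (Equiv.Perm (Fin k))).map fun π =>
      C.move (Equiv.Perm.viaEmbedding (Equiv.prodCongr π (Equiv.refl _)) piles)

/-- Whether an operation is a (pile-scramble) shuffle. -/
def Step.isShuffle {D : Type*} {N : ℕ} : Step D N → Bool
  | .pileScramble _ _ _ => true
  | _ => false

/-- A protocol on `N` cards: a list of operations, executed one after the other with independent
random choices. -/
abbrev Protocol (D : Type*) (N : ℕ) : Type _ := List (Step D N)

/-- The law of the final configuration of a protocol. -/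
noncomputable def Protocol.run {D : Type*} {N : ℕ} : Protocol D N → Config D N → PMF (Config D N)
  | [], C => PMF.pure C
  | s :: p, C => (s.exec C).bind (Protocol.run p)

/-- The number of pile-scramble shuffles of a protocol. -/
def Protocol.shuffleCount {D : Type*} {N : ℕ} (p : Protocol D N) : ℕ := p.countP Step.isShuffle

/-- The generalized pile-scramble protocol: `n` piles lie on the table, the `i`-th consists of
`size i` cards at the positions `pos ⟨i, 0⟩, pos ⟨i, 1⟩, …`. For each size that occurs, one
pile-scramble shuffle is applied to all piles of that size. -/
def generalizedPileScramble {D : Type*} {N n : ℕ} (size : Fin n → ℕ)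
    (pos : (Σ i, Fin (size i)) ↪ Fin N) : Protocol D N :=
  ((Finset.univ.image size).sort (· ≤ ·)).map fun s =>
    let A : Finset (Fin n) := Finset.univ.filter fun i => size i = s
    have hA : ∀ a : Fin A.card, size (A.orderEmbOfFin rfl a) = s := fun a =>
      (Finset.mem_filter.1 (A.orderEmbOfFin_mem rfl a)).2
    .pileScramble A.card s
      { toFun := fun p => pos ⟨A.orderEmbOfFin rfl p.1, Fin.cast (hA p.1).symm p.2⟩
        inj' := by
          rintro ⟨a, b⟩ ⟨a', b'⟩ h
          have h' := pos.injective h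
          have h1 : a = a' := (A.orderEmbOfFin rfl).injective (congrArg Sigma.fst h')
          subst h1
          simpa [Fin.ext_iff] using h' }

end CardProtocol

/-! ### The graph shuffle protocol -/

namespace GraphShuffle

open CardProtocol DirectedGraph

/-- Split off the first slot of each block of slots. -/
def splitFirst {n : ℕ} (d : Fin n → ℕ) : (Σ i, Fin (d i + 1)) ≃ Fin n ⊕ (Σ i, Fin (d i)) where
  toFun p := Fin.cases (motive := fun _ => Fin n ⊕ (Σ i, Fin (d i)))
    (Sum.inl p.1) (fun s => Sum.inr ⟨p.1, s⟩) p.2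
  invFun := Sum.elim (fun i => ⟨i, 0⟩) (fun q => ⟨q.1, q.2.succ⟩)
  left_inv := by
    rintro ⟨i, s⟩
    refine Fin.cases ?_ (fun s => ?_) s <;> simp
  right_inv := by
    rintro (i | ⟨i, s⟩) <;> simp

section

variable {n : ℕ} {E : Type*} [Fintype E] (G : DirectedGraph (Fin n) E) {D : Type*}

/-- The positions at the start: first the `n` input cards, then `n` consecutive piles, the `i`-th
of which has `in(i) + 1` cards. -/
def startLayout : Fin n ⊕ (Σ i, Fin (G.indeg i + 1)) ≃ Fin (2 * n + Fintype.card E) :=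
  (Equiv.sumCongr (Equiv.refl _) finSigmaFinEquiv).trans <| finSumFinEquiv.trans <| finCongr <| by
    rw [Finset.sum_add_distrib, G.sum_indeg]
    simp
    omega

/-- The positions of `n` consecutive piles, the `i`-th of which has `d i + 2` cards. -/
def pileLayout (d : Fin n → ℕ) (hd : ∑ i, d i = Fintype.card E) :
    (Σ i, Fin (d i + 2)) ≃ Fin (2 * n + Fintype.card E) :=
  finSigmaFinEquiv.trans <| finCongr <| by
    rw [Finset.sum_add_distrib, hd]
    simp
    omega

/-- The positions of the piles `vertex[1], …, vertex[n]`, where `vertex[i]` has `out(i) + 2`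
cards. -/
def vertexLayout : (Σ i, Fin (G.outdeg i + 2)) ≃ Fin (2 * n + Fintype.card E) :=
  pileLayout G.outdeg G.sum_outdeg

/-- The positions of the `out(i)` cards of `vertex[i]` after the second card, as piles of one card
each. -/
def edgeSlots (i : Fin n) : Fin (G.outdeg i) × Fin 1 ↪ Fin (2 * n + Fintype.card E) where
  toFun p := vertexLayout G ⟨i, p.1.succ.succ⟩
  inj' := by
    rintro ⟨a, b⟩ ⟨a', b'⟩ h
    have h' := (vertexLayout G).injective h
    simp only [Sigma.mk.injEq, heq_eq_eq, true_and, Fin.succ_inj] at h'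
    exact Prod.ext h' (Subsingleton.elim _ _)

/-- The positions after the vertex piles have been rearranged such that the `i`-th pile is the one
that was the `δ i`-th pile. -/
def sortedLayout (δ : Equiv.Perm (Fin n)) :
    (Σ i, Fin (G.outdeg (δ i) + 2)) ≃ Fin (2 * n + Fintype.card E) :=
  pileLayout (fun i => G.outdeg (δ i)) ((Equiv.sum_comp δ G.outdeg).trans G.sum_outdeg)

/-- The card-sequence at the start: the input `x` face down, followed by piles of face-up helping
cards, the `i`-th of which consists of `in(i) + 1` copies of the card with symbol `num i`. -/
def startCards (num : Fin n ↪ D) (x : Fin n → D) : Fin (2 * n + Fintype.card E) → Card D :=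
  fun q => Sum.elim (fun i => ⟨x i, false⟩) (fun p => ⟨num p.1, true⟩) ((startLayout G).symm q)

/-- How the piles `vertex[i]` are built. Their first card is the `i`-th input card and their second
card comes from the pile now lying at the `i`-th place (its first card). Their further cards
correspond to the edges leaving `i`: for an edge `e` one of the further cards of the pile now lying
at place `t(e)` is used. Which card is used for which edge, and the order of the edges in
`vertex[i]`, are fixed by the enumerations `inEnum` and `outEnum`. -/
def buildVertices (inEnum : ∀ i, Fin (G.indeg i) ≃ {e : E // G.tgt e = i})
    (outEnum : ∀ i, Fin (G.outdeg i) ≃ {e : E // G.src e = i}) :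
    Equiv.Perm (Fin (2 * n + Fintype.card E)) :=
  let edgesIn : (Σ i, Fin (G.indeg i)) ≃ E :=
    (Equiv.sigmaCongrRight inEnum).trans (Equiv.sigmaFiberEquiv G.tgt)
  let edgesOut : (Σ i, Fin (G.outdeg i)) ≃ E :=
    (Equiv.sigmaCongrRight outEnum).trans (Equiv.sigmaFiberEquiv G.src)
  let slotsIn : (Σ i, Fin (G.indeg i + 1)) ≃ Fin n ⊕ E :=
    (splitFirst G.indeg).trans (Equiv.sumCongr (Equiv.refl _) edgesIn)
  let slotsOut : (Σ i, Fin (G.outdeg i + 1)) ≃ Fin n ⊕ E :=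
    (splitFirst G.outdeg).trans (Equiv.sumCongr (Equiv.refl _) edgesOut)
  (startLayout G).symm.trans <|
    (Equiv.sumCongr (Equiv.refl _) (slotsIn.trans slotsOut.symm)).trans <|
      (splitFirst fun i => G.outdeg i + 1).symm.trans (vertexLayout G)

/-- The order in which the opened vertex piles have to be taken such that their second cards are in
ascending order: the second card of pile `δ i` shows `num i`. -/
noncomputable def sortOrder (num : Fin n ↪ D) (v : Visible D (2 * n + Fintype.card E)) :
    Equiv.Perm (Fin n) :=
  Classical.epsilon fun δ => ∀ i, v (vertexLayout G ⟨δ i, 1⟩) = some (num i)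

/-- Sort the opened vertex piles: pile `δ i` becomes the `i`-th pile. -/
noncomputable def sortPiles (num : Fin n ↪ D) (v : Visible D (2 * n + Fintype.card E)) :
    Equiv.Perm (Fin (2 * n + Fintype.card E)) :=
  let δ := sortOrder G num v
  (vertexLayout G).symm.trans <|
    (Equiv.sigmaCongrLeft (β := fun i => Fin (G.outdeg i + 2)) δ).symm.trans (sortedLayout G δ)

/-- The order by which the piles were sorted, read off from a trace that ends with the opened
sequence and the sorted sequence. -/
noncomputable def openedOrder (num : Fin n ↪ D) (t : Trace D (2 * n + Fintype.card E)) :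
    Equiv.Perm (Fin n) :=
  sortOrder G num (Trace.last t.tail)

open Classical in
/-- The graph `G'` read off from the sorted opened piles at the end of the trace `t`: for each pile
`i` and each card `j` after the second card of that pile, there is an edge `i → j` (the default
target `i` is never used for a card that shows one of the symbols `num j`). -/
noncomputable def openedGraph (num : Fin n ↪ D) (t : Trace D (2 * n + Fintype.card E)) :
    DirectedGraph (Fin n) (Σ i, Fin (G.outdeg (openedOrder G num t i))) where
  src e := e.1
  tgt e :=
    if h : ∃ j, Trace.last t (sortedLayout G (openedOrder G num t) ⟨e.1, e.2.succ.succ⟩)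
        = some (num j)
    then h.choose else e.1

/-- The last rearrangement: the first card `yᵢ` of the `i`-th pile becomes the `ψ i`-th card of the
output, and the other cards, which are all open, are put back to the places of the helping cards
with their symbols at the start. -/
noncomputable def arrangeOutput (num : Fin n ↪ D) (ψ : Equiv.Perm (Fin n))
    (t : Trace D (2 * n + Fintype.card E)) : Equiv.Perm (Fin (2 * n + Fintype.card E)) :=
  Classical.epsilon fun π =>
    (∀ i, π (sortedLayout G (openedOrder G num t) ⟨i, 0⟩) = startLayout G (Sum.inl (ψ i))) ∧
    ∀ p, Trace.last t (π.symm (startLayout G (Sum.inr p))) = some (num p.1)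

/-- The graph shuffle protocol for `G`. The function `ψ` is the choice of the isomorphism
`G' → G` (its vertex part), which may depend on everything that has been visible. -/
noncomputable def graphShuffleProtocol (num : Fin n ↪ D)
    (inEnum : ∀ i, Fin (G.indeg i) ≃ {e : E // G.tgt e = i})
    (outEnum : ∀ i, Fin (G.outdeg i) ≃ {e : E // G.src e = i})
    (ψ : Trace D (2 * n + Fintype.card E) → Equiv.Perm (Fin n)) :
    Protocol D (2 * n + Fintype.card E) :=
  -- turn the helping cards face down and scramble their piles
  [.turn (Finset.univ.image fun p => startLayout G (Sum.inr p))] ++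
  generalizedPileScramble (fun i => G.indeg i + 1)
    (Function.Embedding.inr.trans (startLayout G).toEmbedding) ++
  -- build the piles `vertex[i]`
  [.perm fun _ => buildVertices G inEnum outEnum] ++
  -- in each pile, scramble the cards after the second one
  (List.finRange n).map (fun i => .pileScramble (G.outdeg i) 1 (edgeSlots G i)) ++
  -- scramble the piles
  generalizedPileScramble (fun i => G.outdeg i + 2) (vertexLayout G).toEmbedding ++
  -- open all cards except the first one of each pile
  [.turn (Finset.univ.image fun p : Σ i, Fin (G.outdeg i + 1) =>
      vertexLayout G ⟨p.1, p.2.succ⟩),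
  -- sort the piles by their second cards
   .perm fun t => sortPiles G num (Trace.last t),
  -- arrange the output by means of the isomorphism
   .perm fun t => arrangeOutput G num (ψ t) t]

end

end GraphShuffle

/-! ### Uniform laws -/

namespace PMF

/-! All randomness sits in three independent uniform choices: `β`, a permutation of the helping
piles preserving indegrees; `ρ`, a permutation of the edge cards at each vertex; and `γ`, a
permutation of the vertex piles preserving outdegrees. A generalized pile-scramble yields such a
uniform choice because the shuffles of the separate sizes commute and generate all size-preserving
permutations; a random product of commuting uniform factors is then uniform on the group they
generate (`randomProduct_eq_uniform`).

The input cards are never opened, so the trace is a function of `(β, ρ, γ)` alone. The vertex pile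
at place `γ i` shows `β⁻¹ i`, so sorting uses the order `γ β`, and `β` itself is an isomorphism from
the opened graph to `G` (`inPerm_mem_Iso0`). The chosen `ψ` is another one, so `σ = ψ β⁻¹` is an
automorphism, and the output is `σ(x)`. Hence one joint law of `σ` and the trace serves every input
(`run_graphShuffleProtocol`).

Uniformity and independence follow from a symmetry. For an automorphism `φ`, the input `x ∘ φ` with
the choices `φ⁻¹ β`, transported `ρ`, and `γ φ` gives the same card-sequence as `x` with `(β, ρ, γ)`
(`startCards_transport`). This substitution preserves the uniform law, so `x` and `x ∘ φ` have the
same final law. An input with distinct symbols lets `σ` be read off the output, so the joint law is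
invariant under right translation of `σ` (`jointLaw_mul`). Such a law is uniform in `σ` and
independent of the trace. -/

theorem eq_uniformOfFintype_of_forall_eq {α : Type*} [Fintype α] [Nonempty α] (p : PMF α)
    (h : ∀ a b, p a = p b) : p = uniformOfFintype α := by
  ext a
  have h1 : (Fintype.card α : ENNReal) * p a = 1 := by
    rw [← p.tsum_coe, tsum_fintype, Finset.sum_congr rfl fun b _ => h b a]
    simp
  rw [uniformOfFintype_apply]
  exact ENNReal.eq_inv_of_mul_eq_one_left (by rwa [mul_comm])

theorem uniformOfFintype_map_equiv {α β : Type*} [Fintype α] [Nonempty α] [Fintype β] [Nonempty β]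
    (e : α ≃ β) : (uniformOfFintype α).map e = uniformOfFintype β := by
  refine eq_uniformOfFintype_of_forall_eq _ fun a b => ?_
  have key : ∀ b, (uniformOfFintype α).map e b = (Fintype.card α : ENNReal)⁻¹ := fun b => by
    classical
    rw [map_apply, tsum_eq_single (e.symm b)]
    · simp
    · intro a ha
      rw [if_neg]
      rintro rfl
      exact ha (by simp)
  rw [key, key]

/-- Change of variables in a uniform draw: this absorbs fixed group factors and justifies the
substitution of random choices under an automorphism. -/
theorem uniformOfFintype_bind_equiv {α β : Type*} [Fintype α] [Nonempty α] (e : α ≃ α)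
    (f : α → PMF β) :
    ((uniformOfFintype α).bind fun a => f (e a)) = (uniformOfFintype α).bind f := by
  conv_rhs => rw [← uniformOfFintype_map_equiv e, bind_map]
  rfl

theorem map_fst_apply {α β : Type*} (J : PMF (α × β)) (a : α) :
    J.map Prod.fst a = ∑' b, J (a, b) := by
  classical
  rw [map_apply, ENNReal.tsum_prod', tsum_eq_single a]
  · simp
  · intro a' ha
    simp [Ne.symm ha]

theorem map_snd_apply {α β : Type*} (J : PMF (α × β)) (b : β) :
    J.map Prod.snd b = ∑' a, J (a, b) := by
  classical
  rw [map_apply, ENNReal.tsum_prod']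
  refine tsum_congr fun a => ?_
  rw [tsum_eq_single b]
  · simp
  · intro b' hb
    simp [Ne.symm hb]

theorem map_apply_of_injective {α β : Type*} (p : PMF α) {f : α → β} (hf : f.Injective) (a : α) :
    p.map f (f a) = p a := by
  classical
  rw [map_apply, tsum_eq_single a]
  · simp
  · intro b hb
    rw [if_neg fun h => hb (hf h.symm)]

/-- If a joint law is invariant under translations of its first component, then the first
component is uniform and independent of the second one. -/
theorem uniform_and_independent_of_invariant {Γ T : Type*} [Group Γ] [Fintype Γ] (J : PMF (Γ × T))
    (h : ∀ σ τ t, J (σ * τ, t) = J (σ, t)) :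
    J.map Prod.fst = uniformOfFintype Γ ∧
      ∀ σ t, J (σ, t) = J.map Prod.fst σ * J.map Prod.snd t := by
  -- Right translation by `σ⁻¹ * τ` carries `σ` to `τ`, so for fixed `t` the joint law is constant
  -- in the group component.
  have hc : ∀ σ τ t, J (σ, t) = J (τ, t) := fun σ τ t => by
    rw [← h σ (σ⁻¹ * τ) t, mul_inv_cancel_left]
  have hu : J.map Prod.fst = uniformOfFintype Γ :=
    eq_uniformOfFintype_of_forall_eq _ fun σ τ => by
      rw [map_fst_apply, map_fst_apply]
      exact tsum_congr fun t => hc σ τ t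
  refine ⟨hu, fun σ t => ?_⟩
  rw [hu, map_snd_apply, tsum_fintype, Finset.sum_congr rfl fun τ _ => hc τ σ t,
    uniformOfFintype_apply]
  simp only [Finset.sum_const, Finset.card_univ, nsmul_eq_mul]
  rw [← mul_assoc, ENNReal.inv_mul_cancel (by simp) (by simp), one_mul]

end PMF

/-! ### Sequences of random multiplications -/

section RandomProduct

variable {ι Γ : Type*} [Group Γ] {K : ι → Type*} [∀ i, Group (K i)] [∀ i, Fintype (K i)]

/-- The law of `fᵢ₍ₘ₎(kₘ) ⋯ fᵢ₍₁₎(k₁)` for a list `i₁, …, iₘ` of indices and independent uniform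
`k₁, …, kₘ`. -/
noncomputable def randomProduct (f : ∀ i, K i →* Γ) : List ι → PMF Γ
  | [] => PMF.pure 1
  | i :: l => (PMF.uniformOfFintype (K i)).bind fun k => (randomProduct f l).map fun h => h * f i k

/-- A factor of index `i` on the right commutes past the factors of other indices until it meets a
uniform element of `K i`, which absorbs it. -/
theorem randomProduct_mul_right (f : ∀ i, K i →* Γ)
    (hf : ∀ i j, i ≠ j → ∀ a b, Commute (f i a) (f j b)) (l : List ι) {i : ι} (hi : i ∈ l) (a : K i) :
    (randomProduct f l).map (fun h => h * f i a) = randomProduct f l := by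
  induction l with
  | nil => simp at hi
  | cons j l ih =>
    rw [randomProduct, PMF.map_bind]
    simp only [PMF.map_comp, Function.comp_def]
    by_cases hij : i = j
    · subst hij
      conv_rhs => rw [← PMF.uniformOfFintype_bind_equiv (Equiv.mulRight a)]
      simp [mul_assoc]
    · have hl : i ∈ l := (List.mem_cons.1 hi).resolve_left hij
      congr 1
      funext k
      conv_rhs => rw [← ih hl, PMF.map_comp]
      congr 1
      funext h
      simp only [Function.comp_def, mul_assoc, (hf i j hij a k).eq]

theorem randomProduct_apply_mul (f : ∀ i, K i →* Γ)
    (hf : ∀ i j, i ≠ j → ∀ a b, Commute (f i a) (f j b)) (l : List ι) {i : ι} (hi : i ∈ l) (a : K i)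
    (g : Γ) : randomProduct f l (g * f i a) = randomProduct f l g := by
  conv_lhs => rw [← randomProduct_mul_right f hf l hi a]
  exact PMF.map_apply_of_injective _ (mul_left_injective (f i a)) g

/-- If the ranges of commuting homomorphisms generate a finite group, then the random product is
uniform. -/
theorem randomProduct_eq_uniform [Fintype Γ] (f : ∀ i, K i →* Γ)
    (hf : ∀ i j, i ≠ j → ∀ a b, Commute (f i a) (f j b)) (l : List ι)
    (hgen : ∀ H : Subgroup Γ, (∀ i ∈ l, ∀ a, f i a ∈ H) → ∀ g, g ∈ H) :
    randomProduct f l = PMF.uniformOfFintype Γ := by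
  -- The right periods of the law form a subgroup. It contains the generators, hence everything, and
  -- then every value equals the value at `1`.
  let H : Subgroup Γ :=
    { carrier := {h | ∀ g, randomProduct f l (g * h) = randomProduct f l g}
      one_mem' := fun g => by rw [mul_one]
      mul_mem' := fun {a b} ha hb g => by rw [← mul_assoc, hb, ha]
      inv_mem' := fun {a} ha g => by rw [← ha (g * a⁻¹), inv_mul_cancel_right] }
  have hH := hgen H fun i hi a g => randomProduct_apply_mul f hf l hi a g
  refine PMF.eq_uniformOfFintype_of_forall_eq _ fun a b => ?_
  have h1 := hH a 1
  have h2 := hH b 1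
  rw [one_mul] at h1 h2
  rw [h1, h2]

end RandomProduct

/-! ### Pile-scramble shuffles of face-down cards -/

namespace CardProtocol

variable {D : Type*} {N : ℕ}

theorem visible_eq_none {c : Fin N → Card D} (hc : ∀ q, (c q).faceUp = false) :
    visible c = fun _ => none := by
  funext q
  simp [visible, hc]

theorem visible_eq_some {c : Fin N → Card D} {q : Fin N} {s : D} (h : visible c q = some s) :
    c q = ⟨s, true⟩ := by
  unfold visible at h
  split_ifs at h with h1
  rw [← h1, ← Option.some.inj h]

theorem Protocol.run_append (p p' : Protocol D N) (C : Config D N) :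
    Protocol.run (p ++ p') C = (Protocol.run p C).bind (Protocol.run p') := by
  induction p generalizing C with
  | nil => simp [Protocol.run]
  | cons s p ih =>
    rw [List.cons_append, Protocol.run, Protocol.run, PMF.bind_bind]
    exact congrArg _ (funext ih)

/-- The law of a list of shuffles of face-down cards, each of which applies the image of a uniformly
random element of a group. -/
theorem run_map_shuffles {ι Γ : Type*} [Group Γ] {K : ι → Type*} [∀ i, Group (K i)]
    [∀ i, Fintype (K i)] (f : ∀ i, K i →* Γ) (P : Γ →* Equiv.Perm (Fin N)) (step : ι → Step D N)
    (hstep : ∀ i C, (step i).exec C =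
      (PMF.uniformOfFintype (K i)).map fun k => C.move (P (f i k)))
    (l : List ι) (C : Config D N) (hC : ∀ q, (C.cards q).faceUp = false) :
    Protocol.run (l.map step) C = (randomProduct f l).map fun g =>
      ⟨fun q => C.cards ((P g).symm q), List.replicate l.length (fun _ => none) ++ C.trace⟩ := by
  induction l generalizing C with
  | nil => simp [Protocol.run, randomProduct, PMF.pure_map, Equiv.Perm.one_def]
  | cons i l ih =>
    rw [List.map_cons, Protocol.run, hstep, PMF.bind_map, randomProduct, PMF.map_bind]
    congr 1
    funext k
    -- The cards remain face down, so every shuffle adds the same blank entry to the trace and only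
    -- the product of the group elements matters.
    have hd : ∀ q, ((C.move (P (f i k))).cards q).faceUp = false := fun q => hC _
    rw [Function.comp_apply, ih _ hd, PMF.map_comp]
    congr 1
    funext g
    simp only [Function.comp_def, Config.move, Config.update, map_mul, Config.mk.injEq]
    refine ⟨rfl, ?_⟩
    rw [visible_eq_none fun q => hC _]
    simp [List.replicate_succ']

end CardProtocol

/-! ### Generalized pile-scrambles -/

namespace CardProtocol

variable {D : Type*} {N n : ℕ}

theorem sigma_fin_ext {d : Fin n → ℕ} {p q : Σ i, Fin (d i)} (h1 : p.1 = q.1)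
    (h2 : (p.2 : ℕ) = q.2) : p = q := by
  obtain ⟨i, j⟩ := p
  obtain ⟨i', j'⟩ := q
  obtain rfl : i = i' := h1
  exact congrArg (Sigma.mk i) (Fin.ext h2)

/-- The permutations of the piles that respect the pile sizes. -/
def sizePerm (size : Fin n → ℕ) : Subgroup (Equiv.Perm (Fin n)) where
  carrier := {β | ∀ i, size (β i) = size i}
  one_mem' := fun _ => rfl
  mul_mem' := fun {a b} ha hb i => (ha (b i)).trans (hb i)
  inv_mem' := fun {a} ha i => by
    have h := ha (a.symm i)
    rw [Equiv.apply_symm_apply] at h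
    exact h.symm

noncomputable instance (size : Fin n → ℕ) : Fintype (sizePerm size) := Fintype.ofFinite _

/-- The action of a size-preserving permutation of the piles on the cards of the piles. -/
def sigmaPermHom (size : Fin n → ℕ) : sizePerm size →* Equiv.Perm (Σ i, Fin (size i)) where
  toFun β :=
    { toFun := fun p => ⟨β.1 p.1, Fin.cast (β.2 p.1).symm p.2⟩
      invFun := fun p => ⟨(β⁻¹).1 p.1, Fin.cast ((β⁻¹).2 p.1).symm p.2⟩
      left_inv := by
        rintro ⟨i, j⟩
        exact sigma_fin_ext (by simp) rfl
      right_inv := by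
        rintro ⟨i, j⟩
        refine Sigma.ext (by simp) ?_
        simp [Fin.heq_ext_iff] }
  map_one' := rfl
  map_mul' _ _ := rfl

/-- The action of a size-preserving permutation of the piles on all positions. -/
noncomputable def pileHom (size : Fin n → ℕ) (pos : (Σ i, Fin (size i)) ↪ Fin N) :
    sizePerm size →* Equiv.Perm (Fin N) :=
  (Equiv.Perm.viaEmbeddingHom pos).comp (sigmaPermHom size)

theorem pileHom_apply (size : Fin n → ℕ) (pos : (Σ i, Fin (size i)) ↪ Fin N) (β : sizePerm size)
    (i : Fin n) (j : Fin (size i)) :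
    pileHom size pos β (pos ⟨i, j⟩) = pos ⟨β.1 i, Fin.cast (β.2 i).symm j⟩ :=
  Equiv.Perm.viaEmbedding_apply _ _ _

theorem pileHom_apply_of_notMem (size : Fin n → ℕ) (pos : (Σ i, Fin (size i)) ↪ Fin N)
    (β : sizePerm size) {q : Fin N} (hq : q ∉ Set.range pos) : pileHom size pos β q = q :=
  Equiv.Perm.viaEmbedding_apply_of_notMem _ _ _ hq

/-- The piles of a given size. -/
abbrev pilesOfSize (size : Fin n → ℕ) (s : ℕ) : Finset (Fin n) :=
  Finset.univ.filter fun i => size i = s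

theorem range_pilesOfSize (size : Fin n → ℕ) (s : ℕ) :
    Set.range ((pilesOfSize size s).orderEmbOfFin rfl) = {i | size i = s} := by
  rw [Finset.range_orderEmbOfFin]
  ext i
  simp

/-- The permutations of the piles of size `s`, as permutations of all piles. -/
noncomputable def sizeHom (size : Fin n → ℕ) (s : ℕ) :
    Equiv.Perm (Fin (pilesOfSize size s).card) →* sizePerm size :=
  (Equiv.Perm.viaEmbeddingHom ((pilesOfSize size s).orderEmbOfFin rfl).toEmbedding).codRestrict _
    fun π i => by
      by_cases hi : size i = s
      · have h : i ∈ Set.range ((pilesOfSize size s).orderEmbOfFin rfl) := by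
          rwa [range_pilesOfSize]
        obtain ⟨a, rfl⟩ := h
        have h1 := Equiv.Perm.viaEmbedding_apply π
          ((pilesOfSize size s).orderEmbOfFin rfl).toEmbedding a
        have h2 : ∀ a, size ((pilesOfSize size s).orderEmbOfFin rfl a) = s := fun a =>
          (Finset.mem_filter.1 ((pilesOfSize size s).orderEmbOfFin_mem rfl a)).2
        exact (congrArg size h1).trans ((h2 _).trans (h2 _).symm)
      · refine congrArg size (Equiv.Perm.viaEmbedding_apply_of_notMem π _ i ?_)
        intro h
        have h' : i ∈ {i | size i = s} := by
          rw [← range_pilesOfSize]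
          exact h
        exact hi h'

theorem sizeHom_apply (size : Fin n → ℕ) (s : ℕ) (π : Equiv.Perm (Fin (pilesOfSize size s).card))
    (a : Fin (pilesOfSize size s).card) :
    (sizeHom size s π).1 ((pilesOfSize size s).orderEmbOfFin rfl a) =
      (pilesOfSize size s).orderEmbOfFin rfl (π a) :=
  Equiv.Perm.viaEmbedding_apply π ((pilesOfSize size s).orderEmbOfFin rfl).toEmbedding a

theorem sizeHom_apply_of_ne (size : Fin n → ℕ) (s : ℕ)
    (π : Equiv.Perm (Fin (pilesOfSize size s).card)) {i : Fin n} (hi : size i ≠ s) :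
    (sizeHom size s π).1 i = i := by
  refine Equiv.Perm.viaEmbedding_apply_of_notMem π _ i fun h => ?_
  have h' : i ∈ {i | size i = s} := by
    rw [← range_pilesOfSize]
    exact h
  exact hi h'

/-- The two permutations have disjoint supports. -/
theorem commute_sizeHom (size : Fin n → ℕ) (s s' : ℕ) (hs : s ≠ s')
    (a : Equiv.Perm (Fin (pilesOfSize size s).card))
    (b : Equiv.Perm (Fin (pilesOfSize size s').card)) :
    Commute (sizeHom size s a) (sizeHom size s' b) := by
  have hd : Equiv.Perm.Disjoint (sizeHom size s a).1 (sizeHom size s' b).1 := fun i => by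
    by_cases hi : size i = s
    · exact Or.inr (sizeHom_apply_of_ne size s' b (hi ▸ hs))
    · exact Or.inl (sizeHom_apply_of_ne size s a hi)
  exact Subtype.ext hd.commute.eq

/-- Every size-preserving permutation agrees on the piles of size `s` with one that fixes all other
piles. -/
theorem exists_sizeHom_eq (size : Fin n → ℕ) (s : ℕ) (β : sizePerm size) :
    ∃ π, ∀ i, size i = s → (sizeHom size s π).1 i = β.1 i := by
  classical
  let e : Fin (pilesOfSize size s).card ≃ {i // size i = s} :=
    ((pilesOfSize size s).orderIsoOfFin rfl).toEquiv.trans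
      (Equiv.subtypeEquivRight fun i => by simp)
  let π : Equiv.Perm (Fin (pilesOfSize size s).card) :=
    e.trans ((β.1.subtypePerm fun i => by rw [β.2 i]).trans e.symm)
  have he : ∀ a, (e a : Fin n) = (pilesOfSize size s).orderEmbOfFin rfl a := fun a => rfl
  refine ⟨π, fun i hi => ?_⟩
  obtain ⟨a, ha⟩ : ∃ a, e a = ⟨i, hi⟩ := ⟨e.symm ⟨i, hi⟩, by simp⟩
  have hi' : i = (pilesOfSize size s).orderEmbOfFin rfl a := by rw [← he, ha]
  conv_lhs => rw [hi']
  rw [sizeHom_apply, ← he]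
  simp [π, ha]

/-- Induction on the list of sizes: dividing `β` by its part on the piles of size `s` leaves a
permutation that only moves piles whose size is in the rest of the list. -/
theorem sizeHom_generate (size : Fin n → ℕ) (H : Subgroup (sizePerm size)) (l : List ℕ)
    (hH : ∀ s ∈ l, ∀ π, sizeHom size s π ∈ H) (β : sizePerm size)
    (hβ : ∀ i, size i ∉ l → β.1 i = i) : β ∈ H := by
  induction l generalizing β with
  | nil =>
    have h : β = 1 := Subtype.ext (Equiv.ext fun i => hβ i (by simp))
    exact h ▸ H.one_mem
  | cons s l ih =>
    obtain ⟨π, hπ⟩ := exists_sizeHom_eq size s β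
    rw [← inv_mul_cancel_right β (sizeHom size s π)]
    refine H.mul_mem (ih (fun t ht => hH t (List.mem_cons_of_mem s ht)) _ fun i hi => ?_)
      (hH s List.mem_cons_self π)
    obtain ⟨j, rfl⟩ := (sizeHom size s π).1.surjective i
    have h1 : (β * (sizeHom size s π)⁻¹).1 ((sizeHom size s π).1 j) = β.1 j := by simp
    rw [h1]
    rw [(sizeHom size s π).2 j] at hi
    by_cases hj : size j = s
    · rw [hπ j hj]
    · rw [sizeHom_apply_of_ne size s π hj]
      exact hβ j (by simp [hj, hi])

theorem randomProduct_sizeHom (size : Fin n → ℕ) :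
    randomProduct (sizeHom size) ((Finset.univ.image size).sort (· ≤ ·)) =
      PMF.uniformOfFintype (sizePerm size) :=
  randomProduct_eq_uniform _ (commute_sizeHom size) _ fun H hH β =>
    sizeHom_generate size H _ hH β fun i hi => absurd (by simp) hi

/-- The law of a generalized pile-scramble of face-down cards. -/
theorem run_generalizedPileScramble (size : Fin n → ℕ) (pos : (Σ i, Fin (size i)) ↪ Fin N)
    (C : Config D N) (hC : ∀ q, (C.cards q).faceUp = false) :
    Protocol.run (generalizedPileScramble size pos) C =
      (PMF.uniformOfFintype (sizePerm size)).map fun β =>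
        ⟨fun q => C.cards ((pileHom size pos β).symm q),
          List.replicate (Finset.univ.image size).card (fun _ => none) ++ C.trace⟩ := by
  rw [← randomProduct_sizeHom, generalizedPileScramble,
    run_map_shuffles (sizeHom size) (pileHom size pos) _ ?_ _ C hC, Finset.length_sort]
  -- It remains to compare one pile-scramble with its lift through `sizeHom`, position by position:
  -- in a pile of size `s`, in another pile, or outside all piles.
  intro s C
  simp only [Step.exec]
  congr 1
  funext π
  congr 1
  ext1 q
  by_cases hq : q ∈ Set.range pos
  · obtain ⟨⟨i, j⟩, rfl⟩ := hq
    rw [pileHom_apply]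
    by_cases hi : size i = s
    · have h : i ∈ Set.range ((pilesOfSize size s).orderEmbOfFin rfl) := by
        rwa [range_pilesOfSize]
      obtain ⟨a, rfl⟩ := h
      refine (Equiv.Perm.viaEmbedding_apply _ _ (a, Fin.cast hi j)).trans (congrArg pos ?_)
      exact sigma_fin_ext (sizeHom_apply size s π a).symm rfl
    · rw [Equiv.Perm.viaEmbedding_apply_of_notMem]
      · exact congrArg pos (sigma_fin_ext (sizeHom_apply_of_ne size s π hi).symm rfl)
      · rintro ⟨⟨a, b⟩, h⟩
        have h' := congrArg Sigma.fst (pos.injective h)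
        refine hi ?_
        rw [← show _ = i from h']
        exact (Finset.mem_filter.1 ((pilesOfSize size s).orderEmbOfFin_mem rfl a)).2
  · rw [pileHom_apply_of_notMem _ _ _ hq, Equiv.Perm.viaEmbedding_apply_of_notMem]
    rintro ⟨p, rfl⟩
    exact hq ⟨_, rfl⟩

theorem shuffleCount_generalizedPileScramble (size : Fin n → ℕ)
    (pos : (Σ i, Fin (size i)) ↪ Fin N) :
    (generalizedPileScramble (D := D) size pos).shuffleCount = (Finset.univ.image size).card := by
  rw [generalizedPileScramble, Protocol.shuffleCount, List.countP_map]
  exact (List.countP_eq_length.2 fun _ _ => rfl).trans (Finset.length_sort _)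

end CardProtocol

/-! ### The scrambling phase of the graph shuffle protocol -/

namespace GraphShuffle

open CardProtocol DirectedGraph

section

variable {n : ℕ} {E : Type*} [Fintype E] (G : DirectedGraph (Fin n) E) {D : Type*}

/-- The positions of all cards after the second card in the piles `vertex[i]`. -/
def edgePos : (Σ i, Fin (G.outdeg i)) ↪ Fin (2 * n + Fintype.card E) where
  toFun p := vertexLayout G ⟨p.1, p.2.succ.succ⟩
  inj' := by
    rintro ⟨i, a⟩ ⟨i', a'⟩ h
    have h' := (vertexLayout G).injective h
    obtain rfl : i = i' := congrArg Sigma.fst h'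
    simpa using h'

/-- The action of permutations of the cards after the second card in each pile `vertex[i]`. -/
noncomputable def edgeHom :
    (∀ i, Equiv.Perm (Fin (G.outdeg i))) →* Equiv.Perm (Fin (2 * n + Fintype.card E)) :=
  (Equiv.Perm.viaEmbeddingHom (edgePos G)).comp (Equiv.Perm.sigmaCongrRightHom _)

theorem edgeHom_apply (ρ : ∀ i, Equiv.Perm (Fin (G.outdeg i))) (i : Fin n)
    (s : Fin (G.outdeg i)) :
    edgeHom G ρ (vertexLayout G ⟨i, s.succ.succ⟩) = vertexLayout G ⟨i, (ρ i s).succ.succ⟩ :=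
  Equiv.Perm.viaEmbedding_apply _ (edgePos G) (⟨i, s⟩ : Σ i, Fin (G.outdeg i))

theorem edgeHom_apply_of_lt_two (ρ : ∀ i, Equiv.Perm (Fin (G.outdeg i))) (i : Fin n)
    (s : Fin (G.outdeg i + 2)) (hs : (s : ℕ) < 2) :
    edgeHom G ρ (vertexLayout G ⟨i, s⟩) = vertexLayout G ⟨i, s⟩ := by
  refine Equiv.Perm.viaEmbedding_apply_of_notMem _ _ _ ?_
  rintro ⟨⟨i', a⟩, h⟩
  have h' := (vertexLayout G).injective h
  obtain rfl : i' = i := congrArg Sigma.fst h'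
  obtain rfl : a.succ.succ = s := by simpa using h'
  simp at hs

/-- The law of the pile-scramble shuffles of the cards after the second card in each pile. -/
theorem run_edgeScrambles (C : Config D (2 * n + Fintype.card E))
    (hC : ∀ q, (C.cards q).faceUp = false) :
    Protocol.run ((List.finRange n).map fun i => .pileScramble (G.outdeg i) 1 (edgeSlots G i)) C =
      (PMF.uniformOfFintype (∀ i, Equiv.Perm (Fin (G.outdeg i)))).map fun ρ =>
        ⟨fun q => C.cards ((edgeHom G ρ).symm q),
          List.replicate n (fun _ => none) ++ C.trace⟩ := by
  have hu : randomProduct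
      (fun i => MonoidHom.mulSingle (fun i => Equiv.Perm (Fin (G.outdeg i))) i)
        (List.finRange n) = PMF.uniformOfFintype _ := by
    -- Permutations at different vertices commute, and those concentrated at a single vertex
    -- generate the product group.
    refine randomProduct_eq_uniform _ (fun i j hij a b => Pi.mulSingle_commute hij a b) _ ?_
    exact fun H hH g => Subgroup.pi_mem_of_mulSingle_mem g fun i => hH i (List.mem_finRange i) _
  rw [← hu, run_map_shuffles (fun i => MonoidHom.mulSingle
    (fun i => Equiv.Perm (Fin (G.outdeg i))) i) (edgeHom G) _ ?_ _ C hC, List.length_finRange]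
  intro i C
  simp only [Step.exec]
  congr 1
  funext π
  congr 1
  ext1 q
  by_cases hq : q ∈ Set.range (edgePos G)
  · obtain ⟨⟨k, s⟩, rfl⟩ := hq
    refine Eq.trans ?_ (edgeHom_apply G _ k s).symm
    by_cases hk : k = i
    · subst hk
      refine (Equiv.Perm.viaEmbedding_apply _ (edgeSlots G k) (s, 0)).trans ?_
      rw [MonoidHom.mulSingle_apply, Pi.mulSingle_eq_same]
      rfl
    · rw [Equiv.Perm.viaEmbedding_apply_of_notMem]
      · rw [MonoidHom.mulSingle_apply, Pi.mulSingle_eq_of_ne hk]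
        rfl
      · rintro ⟨⟨a, b⟩, h⟩
        exact hk (congrArg Sigma.fst ((vertexLayout G).injective h)).symm
  · refine Eq.trans ?_ (Equiv.Perm.viaEmbedding_apply_of_notMem _ _ _ hq).symm
    rw [Equiv.Perm.viaEmbedding_apply_of_notMem]
    rintro ⟨⟨a, b⟩, h⟩
    exact hq ⟨⟨i, a⟩, h⟩

/-! ### Where the scrambling phase takes each card from -/

variable (inEnum : ∀ i, Fin (G.indeg i) ≃ {e : E // G.tgt e = i})
  (outEnum : ∀ i, Fin (G.outdeg i) ≃ {e : E // G.src e = i})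

theorem buildVertices_input (i : Fin n) :
    buildVertices G inEnum outEnum (startLayout G (Sum.inl i)) = vertexLayout G ⟨i, 0⟩ := by
  simp [buildVertices, splitFirst]

theorem buildVertices_vertex (i : Fin n) :
    buildVertices G inEnum outEnum (startLayout G (Sum.inr ⟨i, 0⟩)) = vertexLayout G ⟨i, 1⟩ := by
  simp [buildVertices, splitFirst]

theorem buildVertices_edge (i : Fin n) (s : Fin (G.outdeg i)) :
    buildVertices G inEnum outEnum (startLayout G (Sum.inr ⟨G.tgt (outEnum i s),
        ((inEnum _).symm ⟨outEnum i s, rfl⟩).succ⟩)) = vertexLayout G ⟨i, s.succ.succ⟩ := by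
  have h : (Equiv.sigmaFiberEquiv G.src).symm (outEnum i s : E) = ⟨i, outEnum i s⟩ := by
    rw [Equiv.symm_apply_eq]
    rfl
  have h' : (Equiv.sigmaCongrRight outEnum).symm ⟨i, outEnum i s⟩ = ⟨i, s⟩ := by
    rw [Equiv.symm_apply_eq]
    rfl
  simp [buildVertices, splitFirst, h, h']

/-- The size-preserving permutations of the piles of helping cards. -/
abbrev InPerm : Subgroup (Equiv.Perm (Fin n)) := sizePerm fun i => G.indeg i + 1

/-- The size-preserving permutations of the piles `vertex[i]`. -/
abbrev OutPerm : Subgroup (Equiv.Perm (Fin n)) := sizePerm fun i => G.outdeg i + 2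

theorem outdeg_outPerm (γ : OutPerm G) (i : Fin n) : G.outdeg (γ.1 i) = G.outdeg i :=
  Nat.add_right_cancel (γ.2 i)

/-- The permutation of the positions that is the effect of the whole scrambling phase. -/
noncomputable def scramblePerm (β : InPerm G) (ρ : ∀ i, Equiv.Perm (Fin (G.outdeg i)))
    (γ : OutPerm G) : Equiv.Perm (Fin (2 * n + Fintype.card E)) :=
  pileHom _ (vertexLayout G).toEmbedding γ * edgeHom G ρ * buildVertices G inEnum outEnum *
    pileHom _ (Function.Embedding.inr.trans (startLayout G).toEmbedding) β

theorem pileHom_start_input (β : InPerm G) (i : Fin n) :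
    pileHom _ (Function.Embedding.inr.trans (startLayout G).toEmbedding) β
      (startLayout G (Sum.inl i)) = startLayout G (Sum.inl i) := by
  refine pileHom_apply_of_notMem _ _ _ ?_
  rintro ⟨p, h⟩
  simpa using (startLayout G).injective h

theorem pileHom_start (β : InPerm G) (i : Fin n) (j : Fin (G.indeg i + 1)) :
    pileHom _ (Function.Embedding.inr.trans (startLayout G).toEmbedding) β
      (startLayout G (Sum.inr ⟨i, j⟩)) =
        startLayout G (Sum.inr ⟨β.1 i, Fin.cast (β.2 i).symm j⟩) :=
  pileHom_apply _ (Function.Embedding.inr.trans (startLayout G).toEmbedding) β i j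

theorem pileHom_vertex (γ : OutPerm G) (i : Fin n) (j : Fin (G.outdeg i + 2)) :
    pileHom _ (vertexLayout G).toEmbedding γ (vertexLayout G ⟨i, j⟩) =
      vertexLayout G ⟨γ.1 i, Fin.cast (γ.2 i).symm j⟩ :=
  pileHom_apply _ (vertexLayout G).toEmbedding γ i j

variable (β : InPerm G) (ρ : ∀ i, Equiv.Perm (Fin (G.outdeg i))) (γ : OutPerm G)

/-- The symbol at a position is found by pulling the position back, hence the inverse; the proof
follows the card forward. Only `buildVertices` and `γ` move an input card. -/
theorem scramblePerm_symm_input (i : Fin n) :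
    (scramblePerm G inEnum outEnum β ρ γ).symm (vertexLayout G ⟨γ.1 i, 0⟩) =
      startLayout G (Sum.inl i) := by
  rw [Equiv.symm_apply_eq]
  simp only [scramblePerm, Equiv.Perm.mul_apply]
  rw [pileHom_start_input, buildVertices_input, edgeHom_apply_of_lt_two _ _ _ _ (by simp),
    pileHom_vertex]
  exact congrArg _ (sigma_fin_ext rfl rfl)

/-- The slot `j` within the helping pile is left unspecified because all cards of a pile carry the
same symbol. -/
theorem scramblePerm_symm_vertex (i : Fin n) :
    ∃ j, (scramblePerm G inEnum outEnum β ρ γ).symm (vertexLayout G ⟨γ.1 i, 1⟩) =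
      startLayout G (Sum.inr ⟨β.1.symm i, j⟩) := by
  refine ⟨0, ?_⟩
  have h : (⟨β.1 (β.1.symm i), Fin.cast (β.2 (β.1.symm i)).symm 0⟩ :
      Σ i, Fin (G.indeg i + 1)) = ⟨i, 0⟩ := sigma_fin_ext (by simp) rfl
  rw [Equiv.symm_apply_eq]
  simp only [scramblePerm, Equiv.Perm.mul_apply]
  rw [pileHom_start, h, buildVertices_vertex, edgeHom_apply_of_lt_two _ _ _ _ (by simp),
    pileHom_vertex]
  exact congrArg _ (sigma_fin_ext rfl rfl)

theorem scramblePerm_symm_edge (i : Fin n) (s : Fin (G.outdeg i)) :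
    ∃ j, (scramblePerm G inEnum outEnum β ρ γ).symm
        (vertexLayout G ⟨γ.1 i, Fin.cast (γ.2 i).symm (ρ i s).succ.succ⟩) =
      startLayout G (Sum.inr ⟨β.1.symm (G.tgt (outEnum i s)), j⟩) := by
  have hk : (fun i => G.indeg i + 1) (β.1.symm (G.tgt (outEnum i s))) =
      G.indeg (G.tgt (outEnum i s)) + 1 := by
    have h := β.2 (β.1.symm (G.tgt (outEnum i s)))
    rw [Equiv.apply_symm_apply] at h
    exact h.symm
  -- The slot given to this edge by `inEnum`, shifted by one because the first card of each helping
  -- pile serves as a vertex card.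
  refine ⟨Fin.cast hk.symm ((inEnum _).symm ⟨outEnum i s, rfl⟩).succ, ?_⟩
  rw [Equiv.symm_apply_eq]
  simp only [scramblePerm, Equiv.Perm.mul_apply]
  rw [pileHom_start]
  have h : (⟨β.1 (β.1.symm (G.tgt (outEnum i s))), Fin.cast (β.2 _).symm
      (Fin.cast hk.symm ((inEnum _).symm ⟨outEnum i s, rfl⟩).succ)⟩ : Σ i, Fin (G.indeg i + 1)) =
        ⟨G.tgt (outEnum i s), ((inEnum _).symm ⟨outEnum i s, rfl⟩).succ⟩ :=
    sigma_fin_ext (by simp) rfl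
  rw [h, buildVertices_edge, edgeHom_apply, pileHom_vertex]

/-- The card-sequence with all cards turned face down. -/
def faceDown {N : ℕ} (c : Fin N → Card D) : Fin N → Card D := fun q => ⟨(c q).symbol, false⟩

variable (num : Fin n ↪ D) (x : Fin n → D)

theorem startCards_input (i : Fin n) :
    startCards G num x (startLayout G (Sum.inl i)) = ⟨x i, false⟩ := by
  simp [startCards]

theorem startCards_helping (p : Σ i, Fin (G.indeg i + 1)) :
    startCards G num x (startLayout G (Sum.inr p)) = ⟨num p.1, true⟩ := by
  simp [startCards]

theorem turn_helping :
    (fun q => if q ∈ (Finset.univ.image fun p => startLayout G (Sum.inr p)) then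
      (⟨(startCards G num x q).symbol, !(startCards G num x q).faceUp⟩ : Card D)
        else startCards G num x q) = faceDown (startCards G num x) := by
  funext q
  obtain ⟨i | p, rfl⟩ := (startLayout G).surjective q
  · rw [if_neg (by simp)]
    simp [faceDown, startCards_input]
  · rw [if_pos (by simp)]
    simp [faceDown, startCards_helping]

theorem turn_scrambled :
    (fun q => if q ∈ (Finset.univ.image fun p : Σ i, Fin (G.outdeg i + 1) =>
        vertexLayout G ⟨p.1, p.2.succ⟩) then
      (⟨(faceDown (startCards G num x) ((scramblePerm G inEnum outEnum β ρ γ).symm q)).symbol,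
        !(faceDown (startCards G num x)
          ((scramblePerm G inEnum outEnum β ρ γ).symm q)).faceUp⟩ : Card D)
      else faceDown (startCards G num x) ((scramblePerm G inEnum outEnum β ρ γ).symm q)) =
    fun q => startCards G num x ((scramblePerm G inEnum outEnum β ρ γ).symm q) := by
  funext q
  obtain ⟨⟨i, s⟩, rfl⟩ := (vertexLayout G).surjective q
  obtain ⟨k, rfl⟩ := γ.1.surjective i
  refine Fin.cases ?_ (fun s => ?_) s
  · rw [if_neg]
    · rw [scramblePerm_symm_input]
      simp [faceDown, startCards_input]
    · simp
  · have hs : vertexLayout G ⟨γ.1 k, s.succ⟩ ∈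
        (Finset.univ.image fun p : Σ i, Fin (G.outdeg i + 1) => vertexLayout G ⟨p.1, p.2.succ⟩) :=
      Finset.mem_image.2 ⟨⟨γ.1 k, s⟩, Finset.mem_univ _, rfl⟩
    rw [if_pos hs]
    obtain ⟨i | p, h⟩ := (startLayout G).surjective
      ((scramblePerm G inEnum outEnum β ρ γ).symm (vertexLayout G ⟨γ.1 k, s.succ⟩))
    -- An input card at an opened position would lie in slot `0` of its pile, but opened slots are
    -- successors.
    · rw [← scramblePerm_symm_input G inEnum outEnum β ρ γ] at h
      have h' := (vertexLayout G).injective ((Equiv.injective _) h)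
      obtain rfl : i = k := γ.1.injective (congrArg Sigma.fst h')
      exact absurd (eq_of_heq (Sigma.mk.inj h').2) (Fin.succ_ne_zero s).symm
    · rw [← h]
      simp [faceDown, startCards_helping]

/-- The operations of the graph shuffle protocol up to the opening of the vertex piles. -/
noncomputable def openingProtocol : Protocol D (2 * n + Fintype.card E) :=
  [.turn (Finset.univ.image fun p => startLayout G (Sum.inr p))] ++
  generalizedPileScramble (fun i => G.indeg i + 1)
    (Function.Embedding.inr.trans (startLayout G).toEmbedding) ++
  [.perm fun _ => buildVertices G inEnum outEnum] ++
  (List.finRange n).map (fun i => .pileScramble (G.outdeg i) 1 (edgeSlots G i)) ++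
  generalizedPileScramble (fun i => G.outdeg i + 2) (vertexLayout G).toEmbedding ++
  [.turn (Finset.univ.image fun p : Σ i, Fin (G.outdeg i + 1) =>
      vertexLayout G ⟨p.1, p.2.succ⟩)]

/-- What is visible of the start sequence after a rearrangement of the cards. -/
def movedStart (g : Equiv.Perm (Fin (2 * n + Fintype.card E))) :
    Visible D (2 * n + Fintype.card E) :=
  fun q => visible (startCards G num num) (g.symm q)

/-- Input cards lie face down wherever they are moved, so `num` can stand in for any input. -/
theorem visible_moved (g : Equiv.Perm (Fin (2 * n + Fintype.card E))) :
    visible (fun q => startCards G num x (g.symm q)) = movedStart G num g := by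
  funext q
  obtain ⟨i | p, h⟩ := (startLayout G).surjective (g.symm q)
  · simp [movedStart, visible, ← h, startCards_input]
  · simp [movedStart, visible, ← h, startCards_helping]

/-- The trace before the vertex piles are opened. -/
def hiddenTrace : Trace D (2 * n + Fintype.card E) :=
  List.replicate (Finset.univ.image fun i => G.outdeg i + 2).card (fun _ => none) ++
  (List.replicate n (fun _ => none) ++ (fun _ => none) ::
  (List.replicate (Finset.univ.image fun i => G.indeg i + 1).card (fun _ => none) ++
  [fun _ => none, visible (startCards G num num)]))

/-- The law of the configuration after the opening of the vertex piles. -/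
theorem run_openingProtocol :
    (openingProtocol G inEnum outEnum).run (Config.init (startCards G num x)) =
      (PMF.uniformOfFintype (InPerm G)).bind fun β =>
      (PMF.uniformOfFintype (∀ i, Equiv.Perm (Fin (G.outdeg i)))).bind fun ρ =>
      (PMF.uniformOfFintype (OutPerm G)).map fun γ =>
        ⟨fun q => startCards G num x ((scramblePerm G inEnum outEnum β ρ γ).symm q),
          movedStart G num (scramblePerm G inEnum outEnum β ρ γ) :: hiddenTrace G num⟩ := by
  simp only [openingProtocol, List.append_assoc]
  simp only [List.cons_append, List.nil_append, Protocol.run, Step.exec, PMF.pure_bind,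
    Config.init, Config.update]
  rw [turn_helping, Protocol.run_append, run_generalizedPileScramble _ _ _ (fun _ => rfl),
    PMF.bind_map]
  congr 1
  funext β
  simp only [Function.comp_apply, Protocol.run, Step.exec, PMF.pure_bind, Config.move,
    Config.update]
  rw [Protocol.run_append, run_edgeScrambles _ _ (fun _ => rfl), PMF.bind_map]
  congr 1
  funext ρ
  rw [Function.comp_apply, Protocol.run_append,
    run_generalizedPileScramble _ _ _ (fun _ => rfl), PMF.bind_map, ← PMF.bind_pure_comp]
  congr 1
  funext γ
  have h := turn_scrambled G inEnum outEnum β ρ γ num x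
  have h0 := visible_moved G num x (scramblePerm G inEnum outEnum β ρ γ)
  have h1 : visible (startCards G num x) = visible (startCards G num num) := visible_moved G num x 1
  refine (PMF.pure_bind _ _).trans (congrArg PMF.pure (congrArg₂ Config.mk h (congrArg₂ List.cons
    ((congrArg visible h).trans h0) ?_)))
  rw [hiddenTrace, ← h1]
  rfl

end

end GraphShuffle

/-! ### The phase after the opening of the vertex piles -/

theorem DirectedGraph.symm_trans_mem_Iso0 {V V' V'' E E' E'' : Type*} {G : DirectedGraph V E}
    {G' : DirectedGraph V' E'} {G'' : DirectedGraph V'' E''} {f : V ≃ V'} {g : V ≃ V''}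
    (hf : f ∈ G.Iso0 G') (hg : g ∈ G.Iso0 G'') : f.symm.trans g ∈ G'.Iso0 G'' := by
  obtain ⟨φ, rfl⟩ := hf
  obtain ⟨χ, rfl⟩ := hg
  refine ⟨⟨φ.onVertices.symm.trans χ.onVertices, φ.onEdges.symm.trans χ.onEdges,
    fun e => ?_, fun e => ?_⟩, rfl⟩
  · obtain ⟨e, rfl⟩ := φ.onEdges.surjective e
    simp [φ.src_comm, χ.src_comm]
  · obtain ⟨e, rfl⟩ := φ.onEdges.surjective e
    simp [φ.tgt_comm, χ.tgt_comm]

namespace GraphShuffle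

open CardProtocol DirectedGraph

section

variable {n : ℕ} {E : Type*} [Fintype E] (G : DirectedGraph (Fin n) E) {D : Type*}
  (num : Fin n ↪ D) (x : Fin n → D)
  (inEnum : ∀ i, Fin (G.indeg i) ≃ {e : E // G.tgt e = i})
  (outEnum : ∀ i, Fin (G.outdeg i) ≃ {e : E // G.src e = i})
  (β : InPerm G) (ρ : ∀ i, Equiv.Perm (Fin (G.outdeg i))) (γ : OutPerm G)

theorem movedStart_apply_of_symm {g : Equiv.Perm (Fin (2 * n + Fintype.card E))}
    {q : Fin (2 * n + Fintype.card E)} {p : Σ i, Fin (G.indeg i + 1)}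
    (h : g.symm q = startLayout G (Sum.inr p)) : movedStart G num g q = some (num p.1) := by
  rw [movedStart, h, visible, startCards_helping]
  rfl

theorem movedStart_vertex (i : Fin n) :
    movedStart G num (scramblePerm G inEnum outEnum β ρ γ) (vertexLayout G ⟨γ.1 i, 1⟩) =
      some (num (β.1.symm i)) := by
  obtain ⟨j, h⟩ := scramblePerm_symm_vertex G inEnum outEnum β ρ γ i
  exact movedStart_apply_of_symm G num h

theorem movedStart_edge (i : Fin n) (s : Fin (G.outdeg i)) :
    movedStart G num (scramblePerm G inEnum outEnum β ρ γ)
        (vertexLayout G ⟨γ.1 i, Fin.cast (γ.2 i).symm (ρ i s).succ.succ⟩) =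
      some (num (β.1.symm (G.tgt (outEnum i s)))) := by
  obtain ⟨j, h⟩ := scramblePerm_symm_edge G inEnum outEnum β ρ γ i s
  exact movedStart_apply_of_symm G num h

/-- The pile `γ (β i)` shows `num i`, which provides a valid order; injectivity of `num` makes it
the only one. -/
theorem sortOrder_movedStart :
    sortOrder G num (movedStart G num (scramblePerm G inEnum outEnum β ρ γ)) = γ.1 * β.1 := by
  have h : ∃ δ : Equiv.Perm (Fin n), ∀ i, movedStart G num (scramblePerm G inEnum outEnum β ρ γ)
      (vertexLayout G ⟨δ i, 1⟩) = some (num i) :=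
    ⟨γ.1 * β.1, fun i => by
      rw [Equiv.Perm.mul_apply, movedStart_vertex, Equiv.symm_apply_apply]⟩
  have hs := Classical.epsilon_spec h
  refine Equiv.ext fun i => ?_
  obtain ⟨k, hk⟩ := γ.1.surjective (sortOrder G num
    (movedStart G num (scramblePerm G inEnum outEnum β ρ γ)) i)
  have hi := hs i
  change movedStart G num _ (vertexLayout G ⟨sortOrder G num
    (movedStart G num (scramblePerm G inEnum outEnum β ρ γ)) i, 1⟩) = _ at hi
  rw [← hk, movedStart_vertex] at hi
  rw [← hk, ← num.injective (Option.some.inj hi)]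
  simp

theorem sortPiles_apply (v : Visible D (2 * n + Fintype.card E)) (i : Fin n)
    (s : Fin (G.outdeg (sortOrder G num v i) + 2)) :
    sortPiles G num v (vertexLayout G ⟨sortOrder G num v i, s⟩) =
      sortedLayout G (sortOrder G num v) ⟨i, s⟩ := by
  have h : (Equiv.sigmaCongrLeft (β := fun i => Fin (G.outdeg i + 2)) (sortOrder G num v)).symm
      ⟨sortOrder G num v i, s⟩ = ⟨i, s⟩ := by
    rw [Equiv.symm_apply_eq]
    rfl
  simp only [sortPiles, Equiv.trans_apply, Equiv.symm_apply_apply]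
  exact congrArg _ h

/-- The rearrangement of the start sequence that yields the sorted sequence. -/
noncomputable def sortedPerm (g : Equiv.Perm (Fin (2 * n + Fintype.card E))) :
    Equiv.Perm (Fin (2 * n + Fintype.card E)) :=
  sortPiles G num (movedStart G num g) * g

/-- The trace after the sorting of the vertex piles. -/
noncomputable def sortedTrace (g : Equiv.Perm (Fin (2 * n + Fintype.card E))) :
    Trace D (2 * n + Fintype.card E) :=
  movedStart G num (sortedPerm G num g) :: movedStart G num g :: hiddenTrace G num

theorem sortedPerm_symm (g : Equiv.Perm (Fin (2 * n + Fintype.card E))) (i : Fin n)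
    (s : Fin (G.outdeg (sortOrder G num (movedStart G num g) i) + 2)) :
    (sortedPerm G num g).symm (sortedLayout G (sortOrder G num (movedStart G num g)) ⟨i, s⟩) =
      g.symm (vertexLayout G ⟨sortOrder G num (movedStart G num g) i, s⟩) := by
  rw [Equiv.symm_apply_eq, sortedPerm, Equiv.Perm.mul_apply, Equiv.apply_symm_apply,
    sortPiles_apply]

theorem movedStart_sortedPerm (g : Equiv.Perm (Fin (2 * n + Fintype.card E))) (i : Fin n)
    (s : Fin (G.outdeg (sortOrder G num (movedStart G num g) i) + 2)) :
    movedStart G num (sortedPerm G num g)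
        (sortedLayout G (sortOrder G num (movedStart G num g)) ⟨i, s⟩) =
      movedStart G num g (vertexLayout G ⟨sortOrder G num (movedStart G num g) i, s⟩) := by
  rw [movedStart, sortedPerm_symm]
  rfl

theorem openedGraph_tgt (t : Trace D (2 * n + Fintype.card E))
    (e : Σ i, Fin (G.outdeg (openedOrder G num t i))) (j : Fin n)
    (h : Trace.last t (sortedLayout G (openedOrder G num t) ⟨e.1, e.2.succ.succ⟩) =
      some (num j)) : (openedGraph G num t).tgt e = j := by
  have h' : ∃ j, Trace.last t (sortedLayout G (openedOrder G num t) ⟨e.1, e.2.succ.succ⟩) =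
      some (num j) := ⟨j, h⟩
  refine (dif_pos h').trans (num.injective (Option.some.inj ?_))
  rw [← h'.choose_spec, h]

/-- The graph read off from the opened piles is isomorphic to `G`. -/
theorem inPerm_mem_Iso0 :
    β.1 ∈ (openedGraph G num (sortedTrace G num (scramblePerm G inEnum outEnum β ρ γ))).Iso0 G := by
  set g := scramblePerm G inEnum outEnum β ρ γ with hg
  have hδ : ∀ i, sortOrder G num (movedStart G num g) i = γ.1 (β.1 i) := fun i => by
    rw [hg, sortOrder_movedStart, Equiv.Perm.mul_apply]
  have hd : ∀ i, G.outdeg (sortOrder G num (movedStart G num g) i) = G.outdeg (β.1 i) :=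
    fun i => by rw [hδ, outdeg_outPerm]
  let F : (Σ i, Fin (G.outdeg (sortOrder G num (movedStart G num g) i))) ≃
      Σ i, {e : E // G.src e = i} := Equiv.sigmaCongr β.1 fun i =>
    (finCongr (hd i)).trans ((ρ (β.1 i)).symm.trans (outEnum (β.1 i)))
  refine ⟨⟨β.1, F.trans (Equiv.sigmaFiberEquiv G.src), ?_, ?_⟩, rfl⟩
  · rintro ⟨i, s⟩
    exact (outEnum (β.1 i) _).2
  · rintro ⟨i, s⟩
    have hF : (F.trans (Equiv.sigmaFiberEquiv G.src)) ⟨i, s⟩ =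
        outEnum (β.1 i) ((ρ (β.1 i)).symm (Fin.cast (hd i) s)) := rfl
    have h : (openedGraph G num (sortedTrace G num g)).tgt ⟨i, s⟩ =
        β.1.symm (G.tgt (outEnum (β.1 i) ((ρ (β.1 i)).symm (Fin.cast (hd i) s)))) := by
      refine openedGraph_tgt G num _ _ _ ?_
      refine (movedStart_sortedPerm G num g i s.succ.succ).trans ?_
      rw [← movedStart_edge G num inEnum outEnum β ρ γ]
      exact congrArg (fun p => movedStart G num g (vertexLayout G p))
        (sigma_fin_ext (hδ i) (by rw [Equiv.apply_symm_apply]; rfl))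
    exact (congrArg G.tgt hF).trans
      ((Equiv.apply_symm_apply _ _).symm.trans (congrArg β.1 h.symm))

/-! ### The chosen isomorphism and the output -/

variable (ψ : Trace D (2 * n + Fintype.card E) → Equiv.Perm (Fin n))

/-- Both `β` and the chosen `ψ` are isomorphisms from the opened graph to `G`; the existence of `β`
is what makes `hψ` applicable. -/
theorem chosen_mem_Aut0
    (hψ : ∀ t, (DirectedGraph.Iso0 (openedGraph G num t) G).Nonempty →
      ψ t ∈ DirectedGraph.Iso0 (openedGraph G num t) G) :
    ψ (sortedTrace G num (scramblePerm G inEnum outEnum β ρ γ)) * β.1⁻¹ ∈ G.Aut0 :=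
  have h := inPerm_mem_Iso0 G num inEnum outEnum β ρ γ
  symm_trans_mem_Iso0 h (hψ _ ⟨_, h⟩)

theorem sortedPerm_symm_first (i : Fin n) :
    (sortedPerm G num (scramblePerm G inEnum outEnum β ρ γ)).symm
      (sortedLayout G (sortOrder G num
        (movedStart G num (scramblePerm G inEnum outEnum β ρ γ))) ⟨i, 0⟩) =
      startLayout G (Sum.inl (β.1 i)) := by
  rw [sortedPerm_symm, ← scramblePerm_symm_input G inEnum outEnum β ρ γ]
  refine congrArg (fun p => (scramblePerm G inEnum outEnum β ρ γ).symm (vertexLayout G p))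
    (sigma_fin_ext ?_ rfl)
  rw [sortOrder_movedStart, Equiv.Perm.mul_apply]

theorem arrangeOutput_spec (τ : Equiv.Perm (Fin n)) :
    let g := scramblePerm G inEnum outEnum β ρ γ
    let π := arrangeOutput G num τ (sortedTrace G num g)
    (∀ i, π (sortedLayout G (sortOrder G num (movedStart G num g)) ⟨i, 0⟩) =
        startLayout G (Sum.inl (τ i))) ∧
      ∀ p, movedStart G num (sortedPerm G num g) (π.symm (startLayout G (Sum.inr p))) =
        some (num p.1) := by
  intro g π
  -- A witness for the choice in `arrangeOutput`: return every card to its start position, then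
  -- permute the input cards by `τ β⁻¹`.
  let X : Equiv.Perm (Fin (2 * n + Fintype.card E)) :=
    (startLayout G).permCongr (Equiv.sumCongr (β.1.symm.trans τ) (Equiv.refl _))
  refine Classical.epsilon_spec (p := fun π : Equiv.Perm (Fin (2 * n + Fintype.card E)) =>
    (∀ i, π (sortedLayout G (sortOrder G num (movedStart G num g)) ⟨i, 0⟩) =
        startLayout G (Sum.inl (τ i))) ∧
      ∀ p, movedStart G num (sortedPerm G num g) (π.symm (startLayout G (Sum.inr p))) =
        some (num p.1)) ⟨(sortedPerm G num g).symm.trans X, fun i => ?_, fun p => ?_⟩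
  · rw [Equiv.trans_apply, sortedPerm_symm_first]
    simp [X]
  · refine movedStart_apply_of_symm G num ?_
    rw [Equiv.symm_trans_apply, Equiv.symm_symm, Equiv.symm_apply_apply,
      Equiv.symm_apply_eq]
    simp [X]

/-- The cards after the last rearrangement. -/
theorem startCards_arranged (τ : Equiv.Perm (Fin n)) :
    (fun q => startCards G num x
      ((sortedPerm G num (scramblePerm G inEnum outEnum β ρ γ)).symm
        ((arrangeOutput G num τ
          (sortedTrace G num (scramblePerm G inEnum outEnum β ρ γ))).symm q))) =
      startCards G num fun i => x ((τ * β.1⁻¹)⁻¹ i) := by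
  obtain ⟨h1, h2⟩ := arrangeOutput_spec G num inEnum outEnum β ρ γ τ
  funext q
  obtain ⟨i | p, rfl⟩ := (startLayout G).surjective q
  · obtain ⟨k, rfl⟩ := τ.surjective i
    rw [← h1, Equiv.symm_apply_apply, sortedPerm_symm_first, h1, startCards_input,
      startCards_input]
    simp
  · rw [startCards_helping]
    -- The rearrangement is specified only through visible symbols, but a visible symbol determines
    -- the whole card, so the helping cards are restored.
    refine visible_eq_some (c := fun q => startCards G num x
      ((sortedPerm G num (scramblePerm G inEnum outEnum β ρ γ)).symm q)) ?_
    rw [visible_moved]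
    exact h2 p

/-- The visible sequence trace at the end. -/
noncomputable def finalTrace (g : Equiv.Perm (Fin (2 * n + Fintype.card E))) :
    Trace D (2 * n + Fintype.card E) :=
  visible (startCards G num num) :: sortedTrace G num g

/-- After the opening, the protocol is deterministic. -/
theorem run_closing :
    Protocol.run [.perm fun t => sortPiles G num (Trace.last t),
        .perm fun t => arrangeOutput G num (ψ t) t]
      ⟨fun q => startCards G num x ((scramblePerm G inEnum outEnum β ρ γ).symm q),
        movedStart G num (scramblePerm G inEnum outEnum β ρ γ) :: hiddenTrace G num⟩ =
      PMF.pure ⟨startCards G num fun i => x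
        ((ψ (sortedTrace G num (scramblePerm G inEnum outEnum β ρ γ)) * β.1⁻¹)⁻¹ i),
          finalTrace G num (scramblePerm G inEnum outEnum β ρ γ)⟩ := by
  simp only [Protocol.run, Step.exec, PMF.pure_bind]
  set g := scramblePerm G inEnum outEnum β ρ γ with hg
  have h1 : Config.move ⟨fun q => startCards G num x (g.symm q),
        movedStart G num g :: hiddenTrace G num⟩ (sortPiles G num (movedStart G num g)) =
      ⟨fun q => startCards G num x ((sortedPerm G num g).symm q), sortedTrace G num g⟩ :=
    congrArg (Config.mk _) (congrArg₂ List.cons (visible_moved G num x (sortedPerm G num g)) rfl)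
  have h2 := startCards_arranged G num x inEnum outEnum β ρ γ (ψ (sortedTrace G num g))
  have h3 : ∀ y, visible (startCards G num y) = visible (startCards G num num) := fun y =>
    visible_moved G num y 1
  change PMF.pure (Config.move (Config.move _ (sortPiles G num (movedStart G num g)))
    (arrangeOutput G num (ψ (Config.move _ (sortPiles G num (movedStart G num g))).trace)
      (Config.move _ (sortPiles G num (movedStart G num g))).trace)) = _
  rw [h1]
  exact congrArg PMF.pure (congrArg₂ Config.mk h2 (congrArg₂ List.cons
    ((congrArg visible h2).trans (h3 _)) rfl))

end

end GraphShuffle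

/-! ### Invariance under automorphisms and the main theorem -/

namespace GraphShuffle

open CardProtocol DirectedGraph

section

variable {n : ℕ} {E : Type*} [Fintype E] (G : DirectedGraph (Fin n) E) {D : Type*}
  (num : Fin n ↪ D) (x : Fin n → D)
  (inEnum : ∀ i, Fin (G.indeg i) ≃ {e : E // G.tgt e = i})
  (outEnum : ∀ i, Fin (G.outdeg i) ≃ {e : E // G.src e = i})
  (β : InPerm G) (ρ : ∀ i, Equiv.Perm (Fin (G.outdeg i))) (γ : OutPerm G)

/-- An isomorphism restricts to bijections between the edges that leave a vertex. -/
def outEdgeEquiv (φ : Iso G G) (i : Fin n) :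
    {e : E // G.src e = i} ≃ {e : E // G.src e = φ.onVertices i} :=
  φ.onEdges.subtypeEquiv fun e => by rw [φ.src_comm, φ.onVertices.apply_eq_iff_eq]

/-- An isomorphism restricts to bijections between the edges that enter a vertex. -/
def inEdgeEquiv (φ : Iso G G) (i : Fin n) :
    {e : E // G.tgt e = i} ≃ {e : E // G.tgt e = φ.onVertices i} :=
  φ.onEdges.subtypeEquiv fun e => by rw [φ.tgt_comm, φ.onVertices.apply_eq_iff_eq]

theorem outdeg_onVertices (φ : Iso G G) (i : Fin n) :
    G.outdeg (φ.onVertices i) = G.outdeg i :=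
  (Fintype.card_congr (outEdgeEquiv G φ i)).symm

theorem indeg_onVertices (φ : Iso G G) (i : Fin n) :
    G.indeg (φ.onVertices i) = G.indeg i :=
  (Fintype.card_congr (inEdgeEquiv G φ i)).symm

/-- The vertex part of an automorphism preserves the sizes of the piles of helping cards. -/
def isoInPerm (φ : Iso G G) : InPerm G :=
  ⟨φ.onVertices, fun i => congrArg (· + 1) (indeg_onVertices G φ i)⟩

/-- The vertex part of an automorphism preserves the sizes of the vertex piles. -/
def isoOutPerm (φ : Iso G G) : OutPerm G :=
  ⟨φ.onVertices, fun i => congrArg (· + 2) (outdeg_onVertices G φ i)⟩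

/-- How the numbering of the edges that leave a vertex changes under an automorphism. -/
def edgeTransport (φ : Iso G G) (i : Fin n) :
    Fin (G.outdeg i) ≃ Fin (G.outdeg (φ.onVertices i)) :=
  (outEnum i).trans ((outEdgeEquiv G φ i).trans (outEnum (φ.onVertices i)).symm)

/-- The change of the permutations of the cards in the vertex piles under an automorphism. -/
def transportPerm (φ : Iso G G) (i : Fin n) : Equiv.Perm (Fin (G.outdeg i)) :=
  (edgeTransport G outEnum φ i).trans
    ((ρ (φ.onVertices i)).trans (finCongr (outdeg_onVertices G φ i)))

/-- Each component is a component of `ρ` composed with fixed bijections, so `ρ` can be recovered; by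
finiteness injectivity suffices. -/
theorem transportPerm_bijective (φ : Iso G G) :
    Function.Bijective fun ρ : ∀ i, Equiv.Perm (Fin (G.outdeg i)) =>
      transportPerm G outEnum ρ φ := by
  refine Finite.injective_iff_bijective.1 fun ρ ρ' h => ?_
  funext i
  obtain ⟨k, rfl⟩ := φ.onVertices.surjective i
  refine Equiv.ext fun s => ?_
  obtain ⟨s, rfl⟩ := (edgeTransport G outEnum φ k).surjective s
  exact (finCongr (outdeg_onVertices G φ k)).injective (Equiv.congr_fun (congrFun h k) s)

theorem startCards_scrambled_vertex (i : Fin n) :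
    startCards G num x ((scramblePerm G inEnum outEnum β ρ γ).symm (vertexLayout G ⟨γ.1 i, 1⟩)) =
      ⟨num (β.1.symm i), true⟩ := by
  obtain ⟨j, h⟩ := scramblePerm_symm_vertex G inEnum outEnum β ρ γ i
  rw [h, startCards_helping]

theorem startCards_scrambled_edge (i : Fin n) (s : Fin (G.outdeg i)) :
    startCards G num x ((scramblePerm G inEnum outEnum β ρ γ).symm
        (vertexLayout G ⟨γ.1 i, Fin.cast (γ.2 i).symm (ρ i s).succ.succ⟩)) =
      ⟨num (β.1.symm (G.tgt (outEnum i s))), true⟩ := by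
  obtain ⟨j, h⟩ := scramblePerm_symm_edge G inEnum outEnum β ρ γ i s
  rw [h, startCards_helping]

/-- Permuting the input by an automorphism has the same effect as a change of the random
choices. -/
theorem startCards_transport (φ : Iso G G) :
    (fun q => startCards G num (fun i => x (φ.onVertices i))
      ((scramblePerm G inEnum outEnum ((isoInPerm G φ)⁻¹ * β) (transportPerm G outEnum ρ φ)
        (γ * isoOutPerm G φ)).symm q)) =
    fun q => startCards G num x ((scramblePerm G inEnum outEnum β ρ γ).symm q) := by
  set γ' := γ * isoOutPerm G φ with hγ'
  -- Under the new choices the vertex `k` plays the role that `φ k` has under the old ones, both for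
  -- the place of its pile and for the symbols shown.
  have hγ : ∀ i, γ'.1 i = γ.1 (φ.onVertices i) := fun i => rfl
  have hβ : ∀ i, ((isoInPerm G φ)⁻¹ * β).1.symm i = β.1.symm (φ.onVertices i) := fun i => rfl
  funext q
  obtain ⟨⟨i, s⟩, rfl⟩ := (vertexLayout G).surjective q
  obtain ⟨k, rfl⟩ := γ'.1.surjective i
  refine Fin.cases ?_ (fun s => Fin.cases ?_ (fun s => ?_) s) s
  · rw [scramblePerm_symm_input, startCards_input, hγ, scramblePerm_symm_input, startCards_input]
  · refine (startCards_scrambled_vertex G num _ inEnum outEnum _ _ γ' k).trans ?_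
    rw [hβ]
    exact (startCards_scrambled_vertex G num x inEnum outEnum β ρ γ (φ.onVertices k)).symm
  · obtain ⟨s, rfl⟩ := (finCongr (outdeg_outPerm G γ' k)).symm.surjective s
    -- Writing the slot as an image under the transported permutation names the edge behind it:
    -- `outEnum k s` here, its image under `φ` on the other side.
    obtain ⟨s, rfl⟩ := (transportPerm G outEnum ρ φ k).surjective s
    have h1 := startCards_scrambled_edge G num (fun i => x (φ.onVertices i)) inEnum outEnum
      ((isoInPerm G φ)⁻¹ * β) (transportPerm G outEnum ρ φ) γ' k s
    have h2 := startCards_scrambled_edge G num x inEnum outEnum β ρ γ (φ.onVertices k)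
      (edgeTransport G outEnum φ k s)
    have h3 : ((outEnum (φ.onVertices k) (edgeTransport G outEnum φ k s)) : E) =
        φ.onEdges (outEnum k s) := by
      simp [edgeTransport, outEdgeEquiv]
    rw [h3, φ.tgt_comm, ← hβ] at h2
    exact h1.trans h2.symm

theorem movedStart_transport (φ : Iso G G) :
    movedStart G num (scramblePerm G inEnum outEnum ((isoInPerm G φ)⁻¹ * β)
      (transportPerm G outEnum ρ φ) (γ * isoOutPerm G φ)) =
    movedStart G num (scramblePerm G inEnum outEnum β ρ γ) := by
  rw [← visible_moved G num (fun i => num (φ.onVertices i)), startCards_transport]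
  rfl

/-- The law of the opened configuration is invariant under automorphisms of the input. -/
theorem run_openingProtocol_comp (φ : Iso G G) :
    (openingProtocol G inEnum outEnum).run
        (Config.init (startCards G num fun i => x (φ.onVertices i))) =
      (openingProtocol G inEnum outEnum).run (Config.init (startCards G num x)) := by
  rw [run_openingProtocol, run_openingProtocol,
    ← PMF.uniformOfFintype_bind_equiv (Equiv.mulLeft (isoInPerm G φ)⁻¹)]
  congr 1
  funext β
  rw [← PMF.uniformOfFintype_bind_equiv
    (Equiv.ofBijective _ (transportPerm_bijective G outEnum φ))]
  congr 1
  funext ρ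
  rw [← PMF.bind_pure_comp, ← PMF.uniformOfFintype_bind_equiv (Equiv.mulRight (isoOutPerm G φ)),
    ← PMF.bind_pure_comp]
  congr 1
  funext γ
  exact congrArg PMF.pure (congrArg₂ Config.mk
    (startCards_transport G num x inEnum outEnum β ρ γ φ)
    (congrArg₂ List.cons (movedStart_transport G num inEnum outEnum β ρ γ φ) rfl))

/-! ### The joint law of the automorphism and the trace -/

variable (ψ : Trace D (2 * n + Fintype.card E) → Equiv.Perm (Fin n))
    (hψ : ∀ t, (DirectedGraph.Iso0 (openedGraph G num t) G).Nonempty →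
      ψ t ∈ DirectedGraph.Iso0 (openedGraph G num t) G)

theorem graphShuffleProtocol_eq :
    graphShuffleProtocol G num inEnum outEnum ψ = openingProtocol G inEnum outEnum ++
      [.perm fun t => sortPiles G num (Trace.last t),
        .perm fun t => arrangeOutput G num (ψ t) t] := by
  simp [graphShuffleProtocol, openingProtocol]

/-- The joint law of the applied automorphism and the visible sequence trace. -/
noncomputable def jointLaw : PMF (G.Aut0 × Trace D (2 * n + Fintype.card E)) :=
  (PMF.uniformOfFintype (InPerm G)).bind fun β =>
  (PMF.uniformOfFintype (∀ i, Equiv.Perm (Fin (G.outdeg i)))).bind fun ρ =>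
  (PMF.uniformOfFintype (OutPerm G)).map fun γ =>
    (⟨_, chosen_mem_Aut0 G num inEnum outEnum β ρ γ ψ hψ⟩,
      finalTrace G num (scramblePerm G inEnum outEnum β ρ γ))

/-- The final configuration on the input `x` if `p.1` is the applied automorphism and `p.2` the
trace. -/
def outputConfig (p : G.Aut0 × Trace D (2 * n + Fintype.card E)) :
    Config D (2 * n + Fintype.card E) :=
  ⟨startCards G num fun i => x ((p.1 : Equiv.Perm (Fin n))⁻¹ i), p.2⟩

/-- Both laws are images of the same uniform triple `(β, ρ, γ)`, since everything after the opening
is deterministic. -/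
theorem run_graphShuffleProtocol :
    (graphShuffleProtocol G num inEnum outEnum ψ).run (Config.init (startCards G num x)) =
      (jointLaw G num inEnum outEnum ψ hψ).map (outputConfig G num x) := by
  rw [graphShuffleProtocol_eq, Protocol.run_append, run_openingProtocol, jointLaw, PMF.map_bind,
    PMF.bind_bind]
  congr 1
  funext β
  rw [PMF.map_bind, PMF.bind_bind]
  congr 1
  funext ρ
  rw [PMF.map_comp, PMF.bind_map, ← PMF.bind_pure_comp]
  congr 1
  funext γ
  exact run_closing G num x inEnum outEnum β ρ γ ψ

/-- On the input `num` all symbols are distinct, so the output reveals the automorphism. -/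
theorem outputConfig_injective : Function.Injective (outputConfig G num num) := by
  rintro ⟨σ, t⟩ ⟨σ', t'⟩ h
  have h1 := congrArg Config.cards h
  obtain rfl : t = t' := congrArg Config.trace h
  have h2 : (σ : Equiv.Perm (Fin n))⁻¹ = (σ' : Equiv.Perm (Fin n))⁻¹ := Equiv.ext fun i => by
    have h3 := congrFun h1 (startLayout G (Sum.inl i))
    simp only [outputConfig, startCards_input] at h3
    exact num.injective (Card.mk.inj h3).1
  rw [Subtype.ext (inv_injective h2)]

theorem jointLaw_mul (σ τ : G.Aut0) (t : Trace D (2 * n + Fintype.card E)) :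
    jointLaw G num inEnum outEnum ψ hψ (σ * τ, t) = jointLaw G num inEnum outEnum ψ hψ (σ, t) := by
  obtain ⟨τ, φ, rfl⟩ := τ
  set τ : G.Aut0 := ⟨φ.onVertices, φ, rfl⟩
  -- Replacing the input `num` by `num ∘ φ` amounts to replacing the applied `σ` by `σ * τ⁻¹`; the
  -- law of the final configuration does not notice.
  let m : G.Aut0 × Trace D (2 * n + Fintype.card E) → G.Aut0 × Trace D (2 * n + Fintype.card E) :=
    fun p => (p.1 * τ⁻¹, p.2)
  have hm : Function.Injective m := fun p p' h =>
    Prod.ext (mul_right_cancel (Prod.mk.inj h).1) (Prod.mk.inj h).2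
  have h1 : (jointLaw G num inEnum outEnum ψ hψ).map (outputConfig G num num ∘ m) =
      (jointLaw G num inEnum outEnum ψ hψ).map (outputConfig G num num) := by
    rw [← run_graphShuffleProtocol, graphShuffleProtocol_eq, Protocol.run_append,
      ← run_openingProtocol_comp G num num inEnum outEnum φ, ← Protocol.run_append,
      ← graphShuffleProtocol_eq, run_graphShuffleProtocol G num _ inEnum outEnum ψ hψ]
    congr 1
  have h2 := PMF.map_apply_of_injective (jointLaw G num inEnum outEnum ψ hψ)
    ((outputConfig_injective G num).comp hm) (σ * τ, t)
  rw [h1] at h2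
  rw [← h2, ← PMF.map_apply_of_injective _ (outputConfig_injective G num) (σ, t)]
  simp [m]

theorem shuffleCount_graphShuffleProtocol :
    (graphShuffleProtocol G num inEnum outEnum ψ).shuffleCount =
      (Finset.univ.image G.indeg).card + (Finset.univ.image G.outdeg).card + n := by
  -- Pile sizes are degrees shifted by a constant, so they take as many values as the degrees.
  have hc : ∀ (d : Fin n → ℕ) (c : ℕ),
      (Finset.univ.image fun i => d i + c).card = (Finset.univ.image d).card := fun d c => by
    rw [← Finset.card_image_of_injective (Finset.univ.image d) (add_left_injective c),
      Finset.image_image]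
    rfl
  have h1 := shuffleCount_generalizedPileScramble (D := D) (fun i => G.indeg i + 1)
    (Function.Embedding.inr.trans (startLayout G).toEmbedding)
  have h2 := shuffleCount_generalizedPileScramble (D := D) (fun i => G.outdeg i + 2)
    (vertexLayout G).toEmbedding
  have h3 : Protocol.shuffleCount (D := D)
      ((List.finRange n).map fun i => .pileScramble (G.outdeg i) 1 (edgeSlots G i)) = n := by
    rw [Protocol.shuffleCount, List.countP_map]
    exact (List.countP_eq_length.2 fun _ _ => rfl).trans List.length_finRange
  rw [hc] at h1 h2
  rw [Protocol.shuffleCount] at h1 h2 h3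
  simp only [graphShuffleProtocol, Protocol.shuffleCount, List.countP_append, h1, h2, h3]
  simp [Step.isShuffle]
  omega

end

end GraphShuffle

/-- The number of cards is carried by the type of positions. A single `J` chosen before `x`
expresses that the joint law does not depend on the input. -/
theorem mainTheorem2 {n : ℕ} {E : Type*} [Fintype E] (G : DirectedGraph (Fin n) E)
    {D : Type*} (num : Fin n ↪ D)
    (inEnum : ∀ i, Fin (G.indeg i) ≃ {e : E // G.tgt e = i})
    (outEnum : ∀ i, Fin (G.outdeg i) ≃ {e : E // G.src e = i})
    (ψ : CardProtocol.Trace D (2 * n + Fintype.card E) → Equiv.Perm (Fin n))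
    (hψ : ∀ t, (DirectedGraph.Iso0 (GraphShuffle.openedGraph G num t) G).Nonempty →
      ψ t ∈ DirectedGraph.Iso0 (GraphShuffle.openedGraph G num t) G) :
    -- `J` is the joint law of the chosen automorphism and the visible sequence trace
    (∃ J : PMF (G.Aut0 × CardProtocol.Trace D (2 * n + Fintype.card E)),
      -- on every input `x` the final card-sequence consists of `σ(x)` and the helping cards
      (∀ x : Fin n → D,
        (GraphShuffle.graphShuffleProtocol G num inEnum outEnum ψ).run
            (CardProtocol.Config.init (GraphShuffle.startCards G num x)) =
          J.map fun p => ⟨GraphShuffle.startCards G num fun i =>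
            x ((p.1 : Equiv.Perm (Fin n))⁻¹ i), p.2⟩) ∧
      -- correctness
      J.map Prod.fst = PMF.uniformOfFintype G.Aut0 ∧
      -- security
      (∀ σ t, J (σ, t) = J.map Prod.fst σ * J.map Prod.snd t)) ∧
    -- the number of pile-scramble shuffles
    (GraphShuffle.graphShuffleProtocol G num inEnum outEnum ψ).shuffleCount =
      (Finset.univ.image G.indeg).card + (Finset.univ.image G.outdeg).card + n ∧
    ((Finset.univ.image G.indeg).card = (Finset.univ.image G.outdeg).card →
      (GraphShuffle.graphShuffleProtocol G num inEnum outEnum ψ).shuffleCount =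
        2 * (Finset.univ.image G.outdeg).card + n) := by
  exact ⟨⟨GraphShuffle.jointLaw G num inEnum outEnum ψ hψ,
      fun x => GraphShuffle.run_graphShuffleProtocol G num x inEnum outEnum ψ hψ,
      PMF.uniform_and_independent_of_invariant _
        (GraphShuffle.jointLaw_mul G num inEnum outEnum ψ hψ)⟩,
    GraphShuffle.shuffleCount_graphShuffleProtocol G num inEnum outEnum ψ,
    fun h => by
      rw [GraphShuffle.shuffleCount_graphShuffleProtocol, h]
      omega⟩
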